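/- Let $\mathcal K$ be a complex Hilbert space, let $\mathcal H$ be a closed subspace of $\mathcal K$, and let $P$ be the orthogonal projection of $\mathcal K$ onto $\mathcal H$. Let $T$ be a bounded normal operator on $\mathcal H$ and $N$ a bounded normal operator on $\mathcal K$. Let $p,q,r$ be nonnegative integers such that $p<q$ and $\frac{p+q}{2}<r$, and let $\Xi$ be a set of pairs of nonnegative integers such that $\{(p,q),(r,r)\}\subseteq\Xi$ and $$T^{*m}T^n=PN^{*m}N^n|_{\mathcal H}\qquad\text{for all }(m,n)\in\Xi.$$ Then: (i) $T^{*n}T^n=PN^{*n}N^n|_{\mathcal H}$ for all integers $n\ge 0$; (ii) $P$ commutes with $N^d$, where $d:=\gcd\{m-n:(m,n)\in\Xi\}$ is the (positive) greatest common divisor; equivalently, $P$ commutes with $|N|:=(N^*N)^{1/2}$ and with $U^d$, where $N=U|N|$ is the unitary polar decomposition of $N$, that is, $U$ is the unique unitary operator on $\mathcal K$ such that $N=U|N|=|N|U$ and $Ux=x$ for every $x\in\ker N$. -/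

import Mathlib

/-- The compression `P A|_H` of an operator `A` on `K` to a subspace `H` (where `P` is the orthogonal
projection of `K` onto `H`), as an operator on `H`. -/
noncomputable def compress {K : Type*} [NormedAddCommGroup K] [InnerProductSpace ℂ K]
    (H : Submodule ℂ K) [H.HasOrthogonalProjection] (A : K →L[ℂ] K) : H →L[ℂ] H :=
  H.orthogonalProjectionOnto ∘L A ∘L H.subtypeL

theorem coe_compress_apply {K : Type*} [NormedAddCommGroup K] [InnerProductSpace ℂ K]
    (H : Submodule ℂ K) [H.HasOrthogonalProjection] (A : K →L[ℂ] K) (h : H) :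
    (compress H A h : K) = H.starProjection (A h) := rfl

/-- The unitary polar decomposition `N = U |N|` of a (normal) operator `N`: it says that
`N = U |N| = |N| U`, that `U` is unitary, and that `U` is the identity on the kernel of `N`. Here
`CFC.abs N` is `|N| = (N* N)^{1/2}`. -/
structure IsUnitaryPolarDecomposition {K : Type*} [NormedAddCommGroup K] [InnerProductSpace ℂ K]
    [CompleteSpace K] (N U : K →L[ℂ] K) : Prop where
  eq_mul_abs : N = U * CFC.abs N
  eq_abs_mul : N = CFC.abs N * U
  mem_unitary : U ∈ unitary (K →L[ℂ] K)
  apply_of_mem_ker : ∀ x : K, N x = 0 → U x = x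

/-- The greatest common divisor of a set of integers, as a natural number: the largest natural
number dividing all of them, if they are not all zero. -/
noncomputable def intSetGcd (J : Set ℤ) : ℕ := Nat.setGcd (Int.natAbs '' J)

theorem dvd_intSetGcd_iff (J : Set ℤ) (k : ℕ) : k ∣ intSetGcd J ↔ ∀ j ∈ J, (k : ℤ) ∣ j := by
  simp [intSetGcd, Nat.dvd_setGcd_iff, Int.natCast_dvd]

theorem intSetGcd_pos (J : Set ℤ) {j : ℤ} (hj : j ∈ J) (h0 : j ≠ 0) : 0 < intSetGcd J := by
  refine Nat.pos_of_ne_zero fun h => h0 ?_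
  have := (dvd_intSetGcd_iff J 0).1 (by rw [h]) j hj
  simpa using this

section PolarDecomposition

variable {K : Type*} [NormedAddCommGroup K] [InnerProductSpace ℂ K] [CompleteSpace K]

theorem norm_abs_apply (N : K →L[ℂ] K) (x : K) : ‖CFC.abs N x‖ = ‖N x‖ := by
  have hsa : star (CFC.abs N) = CFC.abs N := (CFC.abs_nonneg N).isSelfAdjoint
  have h : star (CFC.abs N) * CFC.abs N = star N * N := by rw [hsa, CFC.abs_mul_abs]
  have h2 := congrArg (fun A : K →L[ℂ] K => inner ℂ (A x) x) h
  simp only [mul_apply_eq_comp, ContinuousLinearMap.star_eq_adjoint,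
    ContinuousLinearMap.adjoint_inner_left, inner_self_eq_norm_sq_to_K] at h2
  have h3 : ‖CFC.abs N x‖ ^ 2 = ‖N x‖ ^ 2 := by exact_mod_cast h2
  exact (sq_eq_sq₀ (norm_nonneg _) (norm_nonneg _)).1 h3

/-- If `A` is normal with the same kernel as `N`, then `ran A + ker N` is dense. -/
theorem denseRange_add_ker (N A : K →L[ℂ] K) (hA : IsStarNormal A)
    (hker : ∀ x, A x = 0 → N x = 0) :
    DenseRange (A.toLinearMap.coprod N.ker.subtype) := by
  have : (LinearMap.range (A.toLinearMap.coprod N.ker.subtype)).topologicalClosure = ⊤ := by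
    rw [Submodule.topologicalClosure_eq_top_iff, Submodule.eq_bot_iff]
    intro z hz
    rw [Submodule.mem_orthogonal] at hz
    have h1 : ContinuousLinearMap.adjoint A z = 0 := by
      refine ext_inner_left ℂ fun x => ?_
      rw [ContinuousLinearMap.adjoint_inner_right, inner_zero_right]
      exact hz _ ⟨(x, 0), by simp⟩
    have h2 : A z = 0 := by
      rw [← norm_eq_zero, (ContinuousLinearMap.isStarNormal_iff_norm_eq_adjoint.1 hA z), h1,
        norm_zero]
    have h3 := hz z ⟨(0, ⟨z, hker z h2⟩), by simp⟩
    exact inner_self_eq_zero.1 h3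
  exact Submodule.dense_iff_topologicalClosure_eq_top.2 this

/-- Every normal operator has exactly one unitary polar decomposition. -/
theorem existsUnique_isUnitaryPolarDecomposition (N : K →L[ℂ] K) (hN : IsStarNormal N) :
    ∃! U : K →L[ℂ] K, IsUnitaryPolarDecomposition N U := by
  have hsa : IsSelfAdjoint (CFC.abs N) := (CFC.abs_nonneg N).isSelfAdjoint
  have hcomm : Commute (CFC.abs N) N := CFC.commute_abs_self N hN
  have hkerA : ∀ x, CFC.abs N x = 0 ↔ N x = 0 := fun x => by
    rw [← norm_eq_zero, norm_abs_apply, norm_eq_zero]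
  have he := denseRange_add_ker N (CFC.abs N) hsa.isStarNormal fun x => (hkerA x).1
  have hf := denseRange_add_ker N N hN fun x => id
  set e := (CFC.abs N).toLinearMap.coprod N.ker.subtype with he_def
  set f := N.toLinearMap.coprod N.ker.subtype with hf_def
  have horth : ∀ (A : K →L[ℂ] K), IsStarNormal A → (∀ x, N x = 0 → A x = 0) → ∀ x y, N y = 0 →
      ‖A x + y‖ ^ 2 = ‖A x‖ ^ 2 + ‖y‖ ^ 2 := by
    intro A hA hk x y hy
    have h1 : ContinuousLinearMap.adjoint A y = 0 := by
      rw [← norm_eq_zero, ← (ContinuousLinearMap.isStarNormal_iff_norm_eq_adjoint.1 hA y),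
        hk y hy, norm_zero]
    have h2 : inner ℂ (A x) y = 0 := by
      rw [← ContinuousLinearMap.adjoint_inner_right, h1, inner_zero_right]
    simpa [sq] using norm_add_sq_eq_norm_sq_add_norm_sq_of_inner_eq_zero (A x) y h2
  have hnorm : ∀ z, ‖f z‖ = ‖e z‖ := by
    rintro ⟨x, y, hy⟩
    have h1 := horth N hN (fun _ h => h) x y hy
    have h2 := horth (CFC.abs N) hsa.isStarNormal (fun x => (hkerA x).2) x y hy
    rw [norm_abs_apply] at h2
    exact (sq_eq_sq₀ (norm_nonneg _) (norm_nonneg _)).1 (h1.trans h2.symm)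
  set U : K →L[ℂ] K := f.extendOfNorm e with hU
  have hUe : ∀ z, U (e z) = f z := fun z =>
    LinearMap.extendOfNorm_eq he ⟨1, fun z => by rw [one_mul, hnorm]⟩ z
  have hiso : ∀ z, ‖U z‖ = ‖z‖ := fun z => by
    refine congrFun (he.equalizer (g := fun z => ‖U z‖) (h := fun z => ‖z‖)
      (by fun_prop) (by fun_prop) ?_) z
    funext z
    simp [hUe, hnorm]
  have hU1 : star U * U = 1 :=
    (ContinuousLinearMap.norm_map_iff_adjoint_comp_self U).1 hiso
  have hU2 : U * star U = 1 := by
    ext z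
    refine congrFun (hf.equalizer (g := fun z => (U * star U) z) (h := fun z => z)
      (by fun_prop) (by fun_prop) ?_) z
    funext w
    have : (U * (star U * U)) (e w) = U (e w) := by rw [hU1, mul_one]
    simpa [hUe] using this
  refine ⟨U, ⟨?_, ?_, Unitary.mem_iff.2 ⟨hU1, hU2⟩, ?_⟩, ?_⟩
  · ext x
    simpa [he_def, hf_def] using (hUe (x, 0)).symm
  · ext x
    refine congrFun (he.equalizer (g := fun z => N z) (h := fun z => CFC.abs N (U z))
      (by fun_prop) (by fun_prop) ?_) x
    funext ⟨x, y, hy⟩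
    have h1 : CFC.abs N (N x) = N (CFC.abs N x) := congrArg (fun A : K →L[ℂ] K => A x) hcomm.eq
    have hy' : N y = 0 := hy
    simp only [Function.comp, hUe]
    simp [he_def, hf_def, h1, hy', (hkerA y).2 hy']
  · intro x hx
    simpa [he_def, hf_def] using hUe (0, ⟨x, hx⟩)
  · intro V hV
    ext x
    refine congrFun (he.equalizer (g := fun z => V z) (h := fun z => U z)
      (by fun_prop) (by fun_prop) ?_) x
    funext ⟨x, y, hy⟩
    have h1 : V (CFC.abs N x) = N x := (congrArg (fun A : K →L[ℂ] K => A x) hV.eq_mul_abs).symm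
    have h2 : V y = y := hV.apply_of_mem_ker y hy
    simp only [Function.comp, hUe]
    simp [he_def, hf_def, h1, h2]

end PolarDecomposition

/-! ### Hansen's inequality for fractional powers, with equality case -/

section CStarAlgebra

open MeasureTheory Set
open scoped NNReal

variable {A : Type*} [CStarAlgebra A] [PartialOrder A] [StarOrderedRing A]

/-! Extend `T` by zero to a normal operator `y` on `K`, and write `N = U|N|`, `y = W|y|`, `s = p + q
< 2r`, `k = q - p`. The moment `(r, r)` says `|y|^(2r) = P|N|^(2r)P`, so Hansen's inequality for the
power `s/(2r) < 1` gives `P|N|^s P ≤ |y|^s` (`compression_nnrpow_le`). The moment `(p, q)` says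
`W^k|y|^s = P U^k|N|^s P`, which forces the reverse inequality (`compression_eq_of_le`). Equality in
Hansen's inequality makes `P` commute with `|N|`, whence `|y| = P|N|P` and (i).

For any other pair, `M = N*^m N^n` and its compression `Q` now satisfy `Q*Q = P M*M P`, so `P`
commutes with `M`. Cancelling `|N|` leaves `U^|m-n|`. The exponents `j` for which `P` commutes with
`U^j` form a subgroup of `ℤ`, which therefore contains `d`. -/

theorem isUnit_algebraMap_add_of_nonneg {c : A} (hc : 0 ≤ c) {t : ℝ} (ht : 0 < t) :
    IsUnit (algebraMap ℝ A t + c) := by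
  have h : IsStrictlyPositive (algebraMap ℝ A t + c) :=
    (isStrictlyPositive_algebraMap (A := A) ht).add_nonneg hc
  exact h.isUnit

theorem cfcₙ_rpowIntegrand₀₁_eq_sub_ringInverse {γ t : ℝ} (hγ : γ ∈ Ioo 0 1) (ht : 0 < t) {c : A}
    (hc : 0 ≤ c) :
    cfcₙ (Real.rpowIntegrand₀₁ γ t) c =
      algebraMap ℝ A (t ^ (γ - 1)) - t ^ γ • Ring.inverse (algebraMap ℝ A t + c) := by
  have hg : ContinuousOn (fun z : ℝ => (t + z)⁻¹) (spectrum ℝ c) := by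
    fun_prop (disch := grind -abstractProof)
  have hspectrum : ∀ r ∈ spectrum ℝ c, t + r ≠ 0 := by grind
  have hg' : ContinuousOn (fun z : ℝ => t ^ γ * (t + z)⁻¹) (spectrum ℝ c) := hg.const_mul _
  have ha : IsSelfAdjoint c := hc.isSelfAdjoint
  have hcont : ContinuousOn (Real.rpowIntegrand₀₁ γ t) (quasispectrum ℝ c) :=
    (Real.continuousOn_rpowIntegrand₀₁_Ici hγ ht).mono fun _ hx =>
      quasispectrum_nonneg_of_nonneg c hc _ hx
  rw [cfcₙ_eq_cfc hcont Real.rpowIntegrand₀₁_zero_right, Real.rpowIntegrand₀₁_eq_sub hγ.2.ne ht]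
  rw [cfc_sub (fun _ : ℝ => t ^ (γ - 1)) (fun z : ℝ => t ^ γ * (t + z)⁻¹) c continuousOn_const hg',
    cfc_const _ c ha, cfc_const_mul _ _ c hg, cfc_inv _ c hspectrum (by fun_prop) ha,
    cfc_const_add _ _ c (by fun_prop) ha, cfc_id' ℝ c ha]

/-- The defect in Hansen's inequality for the resolvent, as a Schur complement. -/
theorem compression_ringInverse_sub_eq {p c : A} (hp : IsStarProjection p) (hc : 0 ≤ c) {t : ℝ}
    (ht : 0 < t) :
    ∃ v : A, star v * (algebraMap ℝ A t + c) * v =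
        p * Ring.inverse (algebraMap ℝ A t + c) * p -
          (Ring.inverse (algebraMap ℝ A t + p * c * p) - t⁻¹ • (1 - p)) ∧
      (v = 0 → Commute p c) := by
  have hpp : p * p = p := hp.isIdempotentElem
  have hps : star p = p := hp.isSelfAdjoint
  have hd : 0 ≤ p * c * p := by simpa [hps] using star_left_conjugate_nonneg hc p
  set τ := algebraMap ℝ A t with hτ
  have hτp : Commute τ p := Algebra.commutes t p
  set L := τ + c with hL
  set L' := τ + p * c * p with hL'
  have hLu : IsUnit L := isUnit_algebraMap_add_of_nonneg hc ht
  have hLu' : IsUnit L' := isUnit_algebraMap_add_of_nonneg hd ht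
  have hτs : star τ = τ := by simp [hτ, ← algebraMap_star_comm]
  have hLs : star L = L := by simp [hL, hτs, hc.isSelfAdjoint.star_eq]
  have hLs' : star L' = L' := by simp [hL', hτs, hd.isSelfAdjoint.star_eq]
  set R := Ring.inverse L with hR
  set R' := Ring.inverse L' with hR'
  have hRL : R * L = 1 := Ring.inverse_mul_cancel _ hLu
  have hLR : L * R = 1 := Ring.mul_inverse_cancel _ hLu
  have hRL' : R' * L' = 1 := Ring.inverse_mul_cancel _ hLu'
  have hLR' : L' * R' = 1 := Ring.mul_inverse_cancel _ hLu'
  have hRs : star R = R := by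
    have : star R * L = 1 := by rw [← hLs, ← star_mul, hLR, star_one]
    calc star R = star R * (L * R) := by rw [hLR, mul_one]
      _ = R := by rw [← mul_assoc, this, one_mul]
  have hRs' : star R' = R' := by
    have : star R' * L' = 1 := by rw [← hLs', ← star_mul, hLR', star_one]
    calc star R' = star R' * (L' * R') := by rw [hLR', mul_one]
      _ = R' := by rw [← mul_assoc, this, one_mul]
  have hpL' : p * L' = L' * p := by
    simp only [hL', mul_add, add_mul, hτp.eq, ← mul_assoc, hpp]
    simp only [mul_assoc, hpp]
  have hpR' : p * R' = R' * p := by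
    calc p * R' = R' * L' * p * R' := by rw [hRL', one_mul]
      _ = R' * (p * L') * R' := by rw [hpL', ← mul_assoc]
      _ = R' * p := by rw [mul_assoc, mul_assoc, hLR', mul_one]
  have hpLp : p * L * p = L' * p := by
    simp only [hL, hL', mul_add, add_mul, ← hτp.eq, mul_assoc, hpp]
  set k := R' * p with hk
  have hks : star k = k := by rw [hk, star_mul, hps, hRs', hpR']
  have hpk : p * k = k := by rw [hk, ← mul_assoc, hpR', mul_assoc, hpp]
  have hkp : k * p = k := by rw [hk, mul_assoc, hpp]
  have hkLk : k * L * k = k := by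
    calc k * L * k = R' * (p * L * p) * R' := by
          simp only [hk, mul_assoc, hpR']
      _ = k := by rw [hpLp, ← mul_assoc, hRL', one_mul, hk, hpR']
  -- `L'` is block diagonal: `p * L * p` on the corner of `p` and `t` on the complement. Removing
  -- the complementary block of `R'` leaves `k`, the inverse of `p * L * p` in the corner.
  have hR'1 : R' - t⁻¹ • (1 - p) = k := by
    have h1 : L' * (t⁻¹ • (1 - p)) = 1 - p := by
      have : τ * (t⁻¹ • (1 - p)) = 1 - p := by
        rw [hτ, ← Algebra.smul_def, smul_smul, mul_inv_cancel₀ ht.ne', one_smul]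
      rw [hL', add_mul, this, mul_assoc, mul_smul_comm, mul_sub, mul_one, hpp,
        sub_self, smul_zero, mul_zero, add_zero]
    have h2 : t⁻¹ • (1 - p) = R' * (1 - p) := by
      calc t⁻¹ • (1 - p) = R' * L' * (t⁻¹ • (1 - p)) := by rw [hRL', one_mul]
        _ = R' * (1 - p) := by rw [mul_assoc, h1]
    rw [h2, hk, mul_sub, mul_one]
    abel
  -- If this witness vanishes, `R * p` equals the self-adjoint `k`, so `p` commutes with the
  -- resolvent `R` and hence with `c`.
  refine ⟨R * p - k, ?_, fun hv => ?_⟩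
  · rw [hR'1, star_sub, star_mul, hRs, hps, hks]
    calc (p * R - k) * L * (R * p - k)
        = p * (R * L) * R * p - p * (R * L) * k - k * (L * R) * p + k * L * k := by noncomm_ring
      _ = p * R * p - k := by rw [hRL, hLR, hkLk]; simp [hpk, hkp]
  · have h1 : R * p = k := sub_eq_zero.1 hv
    have h2 : p * R = R * p := by
      have := congrArg star h1
      rw [star_mul, hRs, hps, hks] at this
      rw [this, h1]
    have h3 : p * L = L * p := by
      calc p * L = L * R * p * L := by rw [hLR, one_mul]
        _ = L * (p * R) * L := by rw [h2, ← mul_assoc]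
        _ = L * p := by rw [mul_assoc, mul_assoc, hRL, mul_one]
    have h4 : c = L - τ := by rw [hL]; abel
    rw [h4]
    exact Commute.sub_right h3 hτp.symm

theorem eq_zero_of_star_mul_mul_self_eq_zero {L v : A} (hL : IsStrictlyPositive L)
    (h : star v * L * v = 0) : v = 0 := by
  have hs : CFC.sqrt L * CFC.sqrt L = L := CFC.sqrt_mul_sqrt_self L hL.nonneg
  have hss : star (CFC.sqrt L) = CFC.sqrt L := (CFC.sqrt_nonneg L).isSelfAdjoint
  have h1 : star (CFC.sqrt L * v) * (CFC.sqrt L * v) = 0 := by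
    rw [star_mul, hss, ← h]
    nth_rewrite 3 [← hs]
    simp only [mul_assoc]
  have h2 : CFC.sqrt L * v = 0 := CStarRing.star_mul_self_eq_zero_iff _ |>.1 h1
  have hu : IsUnit (CFC.sqrt L) := (CFC.isUnit_sqrt_iff L hL.nonneg).2 hL.isUnit
  exact hu.mul_right_eq_zero.1 h2

/-- The integrand is a constant minus `t ^ γ` times a resolvent. The constants differ by `t ^ (γ -
1) • (1 - p)`, which is exactly the complementary block of the resolvent of `p * c * p`, so the
defect is `t ^ γ` times the Schur complement above. -/
theorem compression_rpowIntegrand₀₁_defect {p c : A} (hp : IsStarProjection p) (hc : 0 ≤ c)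
    {γ t : ℝ} (hγ : γ ∈ Ioo 0 1) (ht : 0 < t) :
    0 ≤ cfcₙ (Real.rpowIntegrand₀₁ γ t) (p * c * p) - p * cfcₙ (Real.rpowIntegrand₀₁ γ t) c * p ∧
    (cfcₙ (Real.rpowIntegrand₀₁ γ t) (p * c * p) - p * cfcₙ (Real.rpowIntegrand₀₁ γ t) c * p = 0 →
      Commute p c) := by
  have hpp : p * p = p := hp.isIdempotentElem
  have hps : star p = p := hp.isSelfAdjoint
  have hd : 0 ≤ p * c * p := by simpa [hps] using star_left_conjugate_nonneg hc p
  obtain ⟨v, hv, hcomm⟩ := compression_ringInverse_sub_eq hp hc ht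
  have hL : IsStrictlyPositive (algebraMap ℝ A t + c) :=
    (isStrictlyPositive_algebraMap (A := A) ht).add_nonneg hc
  have key : cfcₙ (Real.rpowIntegrand₀₁ γ t) (p * c * p) -
      p * cfcₙ (Real.rpowIntegrand₀₁ γ t) c * p =
      t ^ γ • (star v * (algebraMap ℝ A t + c) * v) := by
    have e : t ^ γ * t⁻¹ = t ^ (γ - 1) := by
      rw [Real.rpow_sub_one ht.ne', div_eq_mul_inv]
    rw [cfcₙ_rpowIntegrand₀₁_eq_sub_ringInverse hγ ht hd,
      cfcₙ_rpowIntegrand₀₁_eq_sub_ringInverse hγ ht hc, hv, smul_sub, smul_sub, smul_smul, e]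
    simp only [Algebra.algebraMap_eq_smul_one, mul_sub, sub_mul, mul_smul_comm, smul_mul_assoc,
      mul_one, hpp, smul_sub]
    abel
  rw [key]
  refine ⟨smul_nonneg (by positivity) (star_left_conjugate_nonneg hL.nonneg v), fun h => ?_⟩
  have h0 : t ^ γ ≠ 0 := by positivity
  exact hcomm (eq_zero_of_star_mul_mul_self_eq_zero hL ((smul_eq_zero.1 h).resolve_left h0))

/-- Hansen's inequality for `x ↦ x ^ γ` and compressions, with its equality case. -/
theorem compression_nnrpow_le {p c : A} (hp : IsStarProjection p) (hc : 0 ≤ c) {γ : ℝ≥0}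
    (hγ : γ ∈ Ioo 0 1) :
    p * c ^ γ * p ≤ (p * c * p) ^ γ ∧ (p * c ^ γ * p = (p * c * p) ^ γ → Commute p c) := by
  obtain _ | _ := subsingleton_or_nontrivial A
  · exact ⟨(Subsingleton.elim _ _).le, fun _ => Subsingleton.elim _ _⟩
  have hγ' : (γ : ℝ) ∈ Ioo (0 : ℝ) 1 := by exact_mod_cast hγ
  have hps : star p = p := hp.isSelfAdjoint
  have hd : 0 ≤ p * c * p := by simpa [hps] using star_left_conjugate_nonneg hc p
  obtain ⟨μ, hμ⟩ := CFC.exists_measure_nnrpow_eq_integral_cfcₙ_rpowIntegrand₀₁ A hγ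
  obtain ⟨hci, hce⟩ := hμ c hc
  obtain ⟨hdi, hde⟩ := hμ (p * c * p) hd
  let Φ : A →L[ℝ] A :=
    (ContinuousLinearMap.mul ℝ A p).comp ((ContinuousLinearMap.mul ℝ A).flip p)
  have hΦ : ∀ x, Φ x = p * x * p := fun x => by simp [Φ, mul_assoc]
  let G : ℝ → A := fun t => cfcₙ (Real.rpowIntegrand₀₁ γ t) (p * c * p) -
    Φ (cfcₙ (Real.rpowIntegrand₀₁ γ t) c)
  have hGi : Integrable G (μ.restrict (Ioi 0)) := hdi.sub (Φ.integrable_comp hci)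
  have hG0 : ∀ᵐ t ∂μ.restrict (Ioi 0), 0 ≤ G t := by
    filter_upwards [ae_restrict_mem measurableSet_Ioi] with t ht
    simpa only [G, hΦ] using (compression_rpowIntegrand₀₁_defect hp hc hγ' ht).1
  have hGint : ∫ t in Ioi 0, G t ∂μ = (p * c * p) ^ γ - p * c ^ γ * p := by
    rw [hde, ← hΦ (c ^ γ), hce, ← Φ.integral_comp_comm hci,
      ← integral_sub hdi (Φ.integrable_comp hci)]
  refine ⟨sub_nonneg.1 (hGint ▸ integral_nonneg_of_ae hG0), fun heq => ?_⟩
  -- The integrals of `G` over a set and its complement are nonnegative elements of `A` with sum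
  -- zero, so both vanish.
  have hGz : G =ᵐ[μ.restrict (Ioi 0)] 0 := by
    refine hGi.ae_eq_zero_of_forall_setIntegral_eq_zero fun s hs _ => ?_
    have h1 : 0 ≤ ∫ t in s, G t ∂(μ.restrict (Ioi 0)) :=
      integral_nonneg_of_ae (ae_restrict_of_ae hG0)
    have h2 : 0 ≤ ∫ t in sᶜ, G t ∂(μ.restrict (Ioi 0)) :=
      integral_nonneg_of_ae (ae_restrict_of_ae hG0)
    have h3 := integral_add_compl hs hGi
    rw [hGint, heq, sub_self] at h3
    exact le_antisymm (by rw [← h3]; exact le_add_of_nonneg_right h2) h1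
  -- A zero measure would represent `1 ^ γ = 1` as `0`.
  have hne : μ.restrict (Ioi 0) ≠ 0 := fun h => by
    have := (hμ 1 zero_le_one).2
    rw [h, integral_zero_measure] at this
    rw [CFC.nnrpow_eq_rpow hγ.1, CFC.one_rpow] at this
    exact one_ne_zero this
  have : (ae (μ.restrict (Ioi 0))).NeBot := ae_neBot.2 hne
  obtain ⟨t, ht, hGt⟩ := ((ae_restrict_mem measurableSet_Ioi).and hGz).exists
  exact (compression_rpowIntegrand₀₁_defect hp hc hγ' ht).2
    (by simpa only [G, hΦ, Pi.zero_apply] using hGt)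

end CStarAlgebra

/-! ### Compressed moments of normal elements -/

section CStarAlgebra

open Set
open scoped NNReal

variable {A : Type*} [CStarAlgebra A]

theorem IsStarProjection.compress_pow_of_commute {p a : A} (hp : IsStarProjection p)
    (h : Commute p a) {n : ℕ} (hn : 0 < n) : (p * a * p) ^ n = p * a ^ n * p := by
  have hpp : p * p = p := hp.isIdempotentElem
  obtain ⟨n, rfl⟩ := Nat.exists_eq_succ_of_ne_zero hn.ne'
  rw [mul_assoc, ← h.eq, ← mul_assoc, hpp, h.mul_pow, hp.isIdempotentElem.pow_succ_eq,
    mul_assoc, ← (h.pow_right _).eq, ← mul_assoc, hpp]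

/-- With `v = (1 - p) * M * p`, the product `star v * v` is the difference of the two sides of `h`.
-/
theorem mul_eq_mul_mul_of_star_mul_self_eq {p M Q : A} (hp : IsStarProjection p)
    (hQ : Q = p * M * p) (h : star Q * Q = p * (star M * M) * p) : M * p = p * M * p := by
  have hpp : p * p = p := hp.isIdempotentElem
  have hps : star p = p := hp.isSelfAdjoint
  have h1 : star (M * p - p * M * p) * (M * p - p * M * p) = 0 := by
    have e : star Q * Q = p * star M * p * M * p := by
      rw [hQ]
      simp only [star_mul, hps, mul_assoc]
      rw [← mul_assoc p p, hpp]
    have e2 : star (M * p - p * M * p) * (M * p - p * M * p) =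
        p * (star M * M) * p - p * star M * p * M * p - p * star M * p * M * p
          + p * star M * (p * p) * M * p := by
      simp only [star_sub, star_mul, hps]
      noncomm_ring
    rw [e2, hpp, ← h, e]
    abel
  exact sub_eq_zero.1 (CStarRing.star_mul_self_eq_zero_iff _ |>.1 h1)

variable [PartialOrder A] [StarOrderedRing A]

theorem star_pow_mul_pow_eq_abs_pow (x : A) [hx : IsStarNormal x] (n : ℕ) :
    star x ^ n * x ^ n = CFC.abs x ^ (2 * n) := by
  rw [pow_mul, CFC.abs_sq, hx.star_comm_self.mul_pow]

theorem star_mul_self_star_pow_mul_pow (x : A) [hx : IsStarNormal x] (m n : ℕ) :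
    star (star x ^ m * x ^ n) * (star x ^ m * x ^ n) = CFC.abs x ^ (2 * (m + n)) := by
  have h : Commute (star x) x := hx.star_comm_self
  rw [star_mul, star_pow, star_pow, star_star, ← star_pow_mul_pow_eq_abs_pow, pow_add, pow_add]
  have e : x ^ m * star x ^ m = star x ^ m * x ^ m := (h.pow_pow m m).eq.symm
  have e2 : x ^ m * x ^ n = x ^ n * x ^ m := pow_mul_comm x m n
  have e3 : star x ^ m * star x ^ n = star x ^ n * star x ^ m := pow_mul_comm _ m n
  calc star x ^ n * x ^ m * (star x ^ m * x ^ n)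
      = star x ^ n * (x ^ m * star x ^ m) * x ^ n := by simp only [mul_assoc]
    _ = (star x ^ n * star x ^ m) * (x ^ m * x ^ n) := by rw [e]; simp only [mul_assoc]
    _ = _ := by rw [e3]

/-- If the compression of `u * e` is `w * Y` with `u`, `w` unitary, `0 ≤ e` commuting with `u` and
`Y` commuting with `w`, then the compression of `e` can be at most `Y` only if it equals `Y`. -/
theorem compression_eq_of_le {p e u w Y : A} (hp : IsStarProjection p) (he : 0 ≤ e)
    (hu : u ∈ unitary A) (hue : Commute u e) (hw : w ∈ unitary A) (hwY : Commute w Y)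
    (hY : IsSelfAdjoint Y) (h : w * Y = p * (u * e) * p) (hle : p * e * p ≤ Y) :
    p * e * p = Y := by
  have hps : star p = p := hp.isSelfAdjoint
  have hww : star w * w = 1 := (Unitary.mem_iff.1 hw).1
  have huu : u * star u = 1 := (Unitary.mem_iff.1 hu).2
  set a := CFC.sqrt e with ha
  have haa : a * a = e := CFC.sqrt_mul_sqrt_self e he
  have has : star a = a := (CFC.sqrt_nonneg e).isSelfAdjoint
  have hua : Commute a u := Commute.cfcₙ_nnreal hue.symm _
  have hua' : a * u = u * a := hua.eq
  have hua'' : star u * a = a * star u := by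
    have := congrArg star hua'
    rwa [star_mul, star_mul, has] at this
  have hYw : star w * Y * w = Y := by rw [mul_assoc, ← hwY.eq, ← mul_assoc, hww, one_mul]
  have h' : Y * star w = p * (a * star u * a) * p := by
    have := congrArg star h
    simp only [star_mul, hY.star_eq, hps] at this
    rw [this, ← haa, star_mul, has]
    simp only [mul_assoc]
    rw [← mul_assoc (star u) a, hua'', mul_assoc]
  -- Both cross terms of this square equal `Y`. Since conjugation by `w` fixes `Y`, the bound `p * e
  -- * p ≤ Y` applied to the conjugated diagonal term leaves `0 ≤ p * e * p - Y`.
  have hpos : 0 ≤ star (a * p - star u * a * p * w) * (a * p - star u * a * p * w) :=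
    star_mul_self_nonneg _
  have hexp : star (a * p - star u * a * p * w) * (a * p - star u * a * p * w) =
      p * e * p + star w * (p * e * p) * w - (2 : ℕ) • Y := by
    have e1 : p * a * star u * a * p = Y * star w := by rw [h']; simp only [mul_assoc]
    have e2 : p * a * u * a * p = w * Y := by
      rw [h, ← haa, mul_assoc p a u, hua']; simp only [mul_assoc]
    calc _ = p * (a * a) * p + star w * (p * (a * (u * star u) * a) * p) * w
          - (p * a * star u * a * p) * w - star w * (p * a * u * a * p) := by
          simp only [star_sub, star_mul, star_star, has, hps]
          noncomm_ring
      _ = _ := by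
          rw [e1, e2, huu, mul_one, haa, mul_assoc Y, hww, ← mul_assoc (star w) w, hww, one_mul,
            mul_one, two_nsmul]
          abel
  have hconj : star w * (p * e * p) * w ≤ Y := by
    calc _ ≤ star w * Y * w := star_left_conjugate_le_conjugate hle w
      _ = Y := hYw
  refine le_antisymm hle ?_
  rw [hexp] at hpos
  have h3 : 0 ≤ p * e * p + Y - (2 : ℕ) • Y := hpos.trans (by gcongr)
  rw [two_nsmul] at h3
  have h4 : p * e * p + Y - (Y + Y) = p * e * p - Y := by abel
  rw [h4] at h3
  exact sub_nonneg.1 h3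

theorem pow_nnrpow_div {a : A} (ha : 0 ≤ a) {s n : ℕ} (hs : 0 < s) (hn : 0 < n) :
    (a ^ n) ^ ((s : ℝ≥0) / n) = a ^ s := by
  have hs' : (0 : ℝ≥0) < s := by exact_mod_cast hs
  have hn' : (0 : ℝ≥0) < n := by exact_mod_cast hn
  have key : ∀ m : ℕ, 0 < m → a ^ m = a ^ (m : ℝ≥0) := fun m hm => by
    rw [CFC.nnrpow_eq_rpow (by exact_mod_cast hm), NNReal.coe_natCast, CFC.rpow_natCast a m ha]
  rw [key n hn, key s hs, CFC.nnrpow_nnrpow, mul_div_cancel₀ _ hn'.ne']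

theorem eq_of_pow_eq_pow_of_nonneg {a b : A} (ha : 0 ≤ a) (hb : 0 ≤ b) {n : ℕ} (hn : 0 < n)
    (h : a ^ n = b ^ n) : a = b := by
  have h1 := pow_nnrpow_div ha one_pos hn
  rw [h, pow_nnrpow_div hb one_pos hn] at h1
  simpa using h1.symm

theorem Commute.of_pow_right_of_nonneg {a p : A} (ha : 0 ≤ a) {n : ℕ} (hn : 0 < n)
    (h : Commute p (a ^ n)) : Commute p a := by
  have h1 := pow_nnrpow_div ha one_pos hn
  rw [pow_one] at h1
  rw [← h1]
  exact (Commute.cfcₙ_nnreal h.symm _).symm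

theorem star_pow_mul_pow_add {x u : A} [IsStarNormal x] (hxu : x = u * CFC.abs x)
    (hux : Commute u (CFC.abs x)) (m k : ℕ) :
    star x ^ m * x ^ (m + k) = u ^ k * CFC.abs x ^ (2 * m + k) := by
  rw [pow_add, ← mul_assoc, star_pow_mul_pow_eq_abs_pow]
  have h : x ^ k = u ^ k * CFC.abs x ^ k := by rw [← hux.mul_pow, ← hxu]
  rw [h, add_comm, pow_add, ← mul_assoc, ← (hux.pow_pow k (2 * m)).eq, mul_assoc, ← pow_add,
    ← pow_add, add_comm k]

/-- If the moments `(m, m + k)` and `(r, r)` of a normal `y` are the compressions by `p` of those of a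
normal `x`, where `0 < k` and `2 * m + k < 2 * r`, then `p` commutes with the modulus of `x`, whose
compression is the modulus of `y`. -/
theorem commute_abs_of_compression_moments {p x y u w : A} [IsStarNormal x] [IsStarNormal y]
    (hp : IsStarProjection p) (hu : u ∈ unitary A) (hxu : x = u * CFC.abs x)
    (hux : Commute u (CFC.abs x)) (hw : w ∈ unitary A) (hyw : y = w * CFC.abs y)
    (hwy : Commute w (CFC.abs y)) {m k r : ℕ} (hk : 0 < k) (hr : 2 * m + k < 2 * r)
    (h1 : star y ^ m * y ^ (m + k) = p * (star x ^ m * x ^ (m + k)) * p)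
    (h2 : star y ^ r * y ^ r = p * (star x ^ r * x ^ r) * p) :
    Commute p (CFC.abs x) ∧ CFC.abs y = p * CFC.abs x * p := by
  have hps : star p = p := hp.isSelfAdjoint
  have ha : 0 ≤ CFC.abs x := CFC.abs_nonneg x
  have hb : 0 ≤ CFC.abs y := CFC.abs_nonneg y
  have hr0 : 0 < 2 * r := by omega
  have hs0 : 0 < 2 * m + k := by omega
  rw [star_pow_mul_pow_eq_abs_pow, star_pow_mul_pow_eq_abs_pow] at h2
  rw [star_pow_mul_pow_add hyw hwy, star_pow_mul_pow_add hxu hux] at h1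
  -- This exponent turns the power `2 * r` of a modulus into the power `2 * m + k` occurring in
  -- `h1`.
  have hγ : ((2 * m + k : ℕ) : ℝ≥0) / (2 * r : ℕ) ∈ Ioo 0 1 := by
    have h3 : (0 : ℝ≥0) < (2 * r : ℕ) := by exact_mod_cast hr0
    have h4 : (0 : ℝ≥0) < (2 * m + k : ℕ) := by exact_mod_cast hs0
    exact ⟨div_pos h4 h3, (div_lt_one h3).2 (by exact_mod_cast hr)⟩
  obtain ⟨hle, heq⟩ := compression_nnrpow_le hp (CStarAlgebra.pow_nonneg ha (2 * r)) hγ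
  rw [← h2, pow_nnrpow_div ha hs0 hr0, pow_nnrpow_div hb hs0 hr0] at hle heq
  have hcomm : Commute p (CFC.abs x) :=
    .of_pow_right_of_nonneg ha hr0 <| heq <| compression_eq_of_le hp (CStarAlgebra.pow_nonneg ha _)
      (pow_mem hu k) (hux.pow_pow k _) (pow_mem hw k) (hwy.pow_pow k _)
      (CStarAlgebra.pow_nonneg hb _).isSelfAdjoint h1 hle
  refine ⟨hcomm, eq_of_pow_eq_pow_of_nonneg hb ?_ hr0 ?_⟩
  · simpa [hps] using star_left_conjugate_nonneg ha p
  · rw [h2, hp.compress_pow_of_commute hcomm hr0]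

/-- For normal `x`, `M = star x ^ m * x ^ n` has `star M * M = |x| ^ (2 * (m + n))`, whose
compression is the same power of `|y|`. Hence `M * p = p * M * p`; exchanging `m` and `n` gives the
same for `star M`. -/
theorem commute_star_pow_mul_pow_of_compression_eq {p x y : A} [IsStarNormal x] [IsStarNormal y]
    (hp : IsStarProjection p) (hc : Commute p (CFC.abs x))
    (habs : CFC.abs y = p * CFC.abs x * p) {m n : ℕ} (hmn : 0 < m + n)
    (h : star y ^ m * y ^ n = p * (star x ^ m * x ^ n) * p) : Commute p (star x ^ m * x ^ n) := by
  have hps : star p = p := hp.isSelfAdjoint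
  have key : ∀ k, 0 < k → CFC.abs y ^ k = p * CFC.abs x ^ k * p := fun k hk => by
    rw [habs, hp.compress_pow_of_commute hc hk]
  have e1 := mul_eq_mul_mul_of_star_mul_self_eq hp h (by
    rw [star_mul_self_star_pow_mul_pow, star_mul_self_star_pow_mul_pow, key _ (by omega)])
  have hstar : ∀ z : A, star (star z ^ m * z ^ n) = star z ^ n * z ^ m := fun z => by simp
  have h' : star y ^ n * y ^ m = p * (star x ^ n * x ^ m) * p := by
    rw [← hstar, h, ← hstar, star_mul, star_mul, hps, ← mul_assoc]
  have e2 := mul_eq_mul_mul_of_star_mul_self_eq hp h' (by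
    rw [star_mul_self_star_pow_mul_pow, star_mul_self_star_pow_mul_pow, key _ (by omega)])
  rw [← hstar x] at e2
  generalize star x ^ m * x ^ n = M at e1 e2 ⊢
  have e3 := congrArg star e2
  rw [star_mul, star_mul, star_mul, star_star, hps, ← mul_assoc] at e3
  exact e3.trans e1.symm

end CStarAlgebra

/-! ### Operators on `H` extended by zero -/

section Compression

variable {K : Type*} [NormedAddCommGroup K] [InnerProductSpace ℂ K]

/-- The extension of an operator on `H` by zero on the orthogonal complement of `H`. -/
noncomputable def extendByZero (H : Submodule ℂ K) [H.HasOrthogonalProjection] (X : H →L[ℂ] H) :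
    K →L[ℂ] K :=
  H.subtypeL ∘L X ∘L H.orthogonalProjectionOnto

variable (H : Submodule ℂ K) [H.HasOrthogonalProjection]

theorem extendByZero_apply (X : H →L[ℂ] H) (x : K) :
    extendByZero H X x = X (H.orthogonalProjectionOnto x) := rfl

theorem extendByZero_injective : Function.Injective (extendByZero H) := fun X Y h => by
  ext x
  simpa [extendByZero_apply] using congrArg (fun A : K →L[ℂ] K => A x) h

theorem extendByZero_one : extendByZero H 1 = H.starProjection := rfl

theorem extendByZero_mul (X Y : H →L[ℂ] H) :
    extendByZero H (X * Y) = extendByZero H X * extendByZero H Y := by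
  ext x
  simp [extendByZero_apply]

theorem extendByZero_compress (A : K →L[ℂ] K) :
    extendByZero H (compress H A) = H.starProjection * A * H.starProjection := rfl

theorem compress_one : compress H 1 = 1 := by
  ext x
  simp [compress]

/-- Extension by zero is not unital: it sends `1` to the projection, hence the positive exponent. -/
theorem extendByZero_pow (X : H →L[ℂ] H) {n : ℕ} (hn : 0 < n) :
    extendByZero H (X ^ n) = extendByZero H X ^ n := by
  induction n, hn using Nat.le_induction with
  | base => simp
  | succ n _ ih => rw [pow_succ, pow_succ, extendByZero_mul, ih]

variable [CompleteSpace K] [CompleteSpace H]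

theorem extendByZero_star (X : H →L[ℂ] H) :
    extendByZero H (star X) = star (extendByZero H X) := by
  refine ContinuousLinearMap.ext fun x => ext_inner_right ℂ fun y => ?_
  rw [ContinuousLinearMap.star_eq_adjoint, ContinuousLinearMap.star_eq_adjoint,
    ContinuousLinearMap.adjoint_inner_left, extendByZero_apply, extendByZero_apply,
    ← Submodule.inner_orthogonalProjectionOnto_eq_of_mem_left,
    ← Submodule.inner_orthogonalProjectionOnto_eq_of_mem_right,
    ContinuousLinearMap.adjoint_inner_left]

theorem extendByZero_star_pow_mul_pow (X : H →L[ℂ] H) {m n : ℕ} (hmn : 0 < m + n) :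
    extendByZero H (star X ^ m * X ^ n) = star (extendByZero H X) ^ m * extendByZero H X ^ n := by
  obtain rfl | hm := m.eq_zero_or_pos
  · simp [extendByZero_pow H X (show 0 < n by omega)]
  obtain rfl | hn := n.eq_zero_or_pos
  · simp [extendByZero_pow H _ hm, extendByZero_star]
  rw [extendByZero_mul, extendByZero_pow H _ hm, extendByZero_pow H _ hn, extendByZero_star]

theorem isStarNormal_extendByZero (X : H →L[ℂ] H) [hX : IsStarNormal X] :
    IsStarNormal (extendByZero H X) := by
  refine ⟨?_⟩
  rw [← extendByZero_star, Commute, SemiconjBy, ← extendByZero_mul, ← extendByZero_mul,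
    hX.star_comm_self.eq]

end Compression

/-! ### Commutation with powers of the unitary polar factor -/

section Polar

variable {K : Type*} [NormedAddCommGroup K] [InnerProductSpace ℂ K] [CompleteSpace K]

theorem IsSelfAdjoint.apply_eq_zero_of_pow_apply_eq_zero {A : K →L[ℂ] K} (hA : IsSelfAdjoint A)
    {n : ℕ} {x : K} (h : (A ^ n) x = 0) : A x = 0 := by
  induction n with
  | zero =>
    have : x = 0 := by simpa using h
    simp [this]
  | succ n ih =>
    obtain _ | n := n
    · simpa using h
    refine ih (inner_self_eq_zero (𝕜 := ℂ) |>.1 ?_)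
    have h1 : (A ^ (n + 1)) x = A ((A ^ n) x) := by rw [pow_succ']; rfl
    have h2 : A ((A ^ (n + 1)) x) = 0 := by rw [← h, pow_succ' A (n + 1)]; rfl
    rw [h1] at h2 ⊢
    rw [← ContinuousLinearMap.adjoint_inner_right, ← ContinuousLinearMap.star_eq_adjoint,
      hA.star_eq, h2, inner_zero_right]

theorem IsUnitaryPolarDecomposition.commute_abs {N U : K →L[ℂ] K}
    (h : IsUnitaryPolarDecomposition N U) : Commute U (CFC.abs N) :=
  h.eq_mul_abs.symm.trans h.eq_abs_mul

/-- The range of `|N| ^ l` together with `ker N` spans a dense subspace. On the range, `|N| ^ l`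
cancels; on `ker N`, which `P` preserves, `U` is the identity. -/
theorem IsUnitaryPolarDecomposition.commute_pow {N U P : K →L[ℂ] K}
    (h : IsUnitaryPolarDecomposition N U) (hP : Commute P (CFC.abs N)) {k l : ℕ}
    (hkl : Commute P (U ^ k * CFC.abs N ^ l)) : Commute P (U ^ k) := by
  have hsa : IsSelfAdjoint (CFC.abs N) := (CFC.abs_nonneg N).isSelfAdjoint
  have hkerA : ∀ x, CFC.abs N x = 0 ↔ N x = 0 := fun x => by
    rw [← norm_eq_zero, norm_abs_apply, norm_eq_zero]
  have hU : ∀ (n : ℕ) x, N x = 0 → (U ^ n) x = x := fun n x hx => by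
    induction n with
    | zero => simp
    | succ n ih => rw [pow_succ', mul_apply_eq_comp, ih, h.apply_of_mem_ker x hx]
  have hPl : Commute P (CFC.abs N ^ l) := hP.pow_right l
  have h1 : P * U ^ k * CFC.abs N ^ l = U ^ k * P * CFC.abs N ^ l := by
    rw [mul_assoc, hkl.eq, mul_assoc, ← hPl.eq, mul_assoc]
  have hd := denseRange_add_ker N (CFC.abs N ^ l) (hsa.pow l).isStarNormal fun x hx =>
    (hkerA x).1 (hsa.apply_eq_zero_of_pow_apply_eq_zero hx)
  refine ContinuousLinearMap.ext fun x => congrFun (hd.equalizer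
    (g := fun z => (P * U ^ k) z) (h := fun z => (U ^ k * P) z) (by fun_prop) (by fun_prop) ?_) x
  funext ⟨x, y, hy⟩
  have hy' : N y = 0 := hy
  have hPy : N (P y) = 0 := by
    rw [← hkerA, ← mul_apply_eq_comp, ← hP.eq, mul_apply_eq_comp, (hkerA y).2 hy', map_zero]
  have h2 := congrArg (fun A : K →L[ℂ] K => A x) h1
  simp only [mul_apply_eq_comp] at h2
  change P ((U ^ k) ((CFC.abs N ^ l) x + y)) = (U ^ k) (P ((CFC.abs N ^ l) x + y))
  rw [map_add, map_add, map_add, map_add, h2, hU k y hy', hU k _ hPy]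

theorem IsUnitaryPolarDecomposition.commute_pow_natAbs {N U P : K →L[ℂ] K} [IsStarNormal N]
    (h : IsUnitaryPolarDecomposition N U) (hPs : IsSelfAdjoint P) (hP : Commute P (CFC.abs N))
    {m n : ℕ} (hmn : Commute P (star N ^ m * N ^ n)) :
    Commute P (U ^ ((m : ℤ) - n).natAbs) := by
  wlog hle : m ≤ n generalizing m n
  · have h1 : Commute P (star N ^ n * N ^ m) := by
      have := hmn.star_star
      simpa [hPs.star_eq] using this
    rw [← Int.natAbs_neg, neg_sub]
    exact this h1 (by omega)
  obtain ⟨k, rfl⟩ := Nat.exists_eq_add_of_le hle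
  rw [star_pow_mul_pow_add h.eq_mul_abs h.commute_abs] at hmn
  simpa using h.commute_pow hP hmn

theorem commute_pow_intSetGcd {M : Type*} [Monoid M] {P : M} {u : Mˣ} {J : Set ℤ}
    (h : ∀ j ∈ J, Commute P ((u : M) ^ j.natAbs)) : Commute P ((u : M) ^ intSetGcd J) := by
  -- Its generator divides every element of `J`, hence their gcd.
  let S : AddSubgroup ℤ :=
    { carrier := {j | Commute P ((u ^ j : Mˣ) : M)}
      zero_mem' := by simp
      add_mem' := fun {a b} ha hb => by
        have := Commute.mul_right ha hb
        simpa [zpow_add] using this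
      neg_mem' := fun {a} ha => by
        have : Commute P (((u ^ a)⁻¹ : Mˣ) : M) := Commute.units_inv_right ha
        simpa [zpow_neg] using this }
  obtain ⟨g, hg⟩ := Int.subgroup_cyclic S
  have hJ : ∀ j ∈ J, j ∈ S := fun j hj => by
    have h1 : ((j.natAbs : ℕ) : ℤ) ∈ S := by
      change Commute P ((u ^ ((j.natAbs : ℕ) : ℤ) : Mˣ) : M)
      rw [zpow_natCast, Units.val_pow_eq_pow_val]
      exact h j hj
    obtain h2 | h2 := Int.natAbs_eq j
    · rwa [h2]
    · rw [h2]; exact neg_mem h1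
  have hdvd : g.natAbs ∣ intSetGcd J := (dvd_intSetGcd_iff J _).2 fun j hj => by
    have := hJ j hj
    rw [hg, AddSubgroup.mem_closure_singleton] at this
    obtain ⟨z, hz⟩ := this
    rw [Int.natAbs_dvd]
    exact ⟨z, by rw [← hz, smul_eq_mul, mul_comm]⟩
  have hmem : (intSetGcd J : ℤ) ∈ S := by
    rw [hg, AddSubgroup.mem_closure_singleton]
    obtain ⟨z, hz⟩ := Int.natAbs_dvd.1 (Int.natCast_dvd_natCast.2 hdvd)
    exact ⟨z, by rw [hz, smul_eq_mul, mul_comm]⟩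
  have : Commute P ((u ^ (intSetGcd J : ℤ) : Mˣ) : M) := hmem
  simpa using this

end Polar

/-! ### The main theorem -/

theorem theorem6p1 {K : Type*} [NormedAddCommGroup K] [InnerProductSpace ℂ K] [CompleteSpace K]
    (H : Submodule ℂ K) [CompleteSpace H]
    (T : H →L[ℂ] H) (hT : IsStarNormal T) (N : K →L[ℂ] K) (hN : IsStarNormal N)
    (p q r : ℕ) (hpq : p < q) (hr : ((p : ℝ) + q) / 2 < r)
    (Ξ : Set (ℕ × ℕ)) (hΞ : {(p, q), (r, r)} ⊆ Ξ)
    (hTN : ∀ m n : ℕ, (m, n) ∈ Ξ → star T ^ m * T ^ n = compress H (star N ^ m * N ^ n))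
    (d : ℕ) (hd : d = intSetGcd ((fun x : ℕ × ℕ => (x.1 : ℤ) - (x.2 : ℤ)) '' Ξ)) :
    (∀ n : ℕ, star T ^ n * T ^ n = compress H (star N ^ n * N ^ n)) ∧
    Commute H.starProjection (N ^ d) ∧
    (∀ U : K →L[ℂ] K, IsUnitaryPolarDecomposition N U →
      (Commute H.starProjection (N ^ d) ↔
        Commute H.starProjection (CFC.abs N) ∧ Commute H.starProjection (U ^ d))) := by
  have hr' : p + q < 2 * r := by
    have : (p : ℝ) + q < 2 * r := by linarith
    exact_mod_cast this
  have hP : IsStarProjection H.starProjection := isStarProjection_starProjection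
  have hS : IsStarNormal (extendByZero H T) := isStarNormal_extendByZero H T
  have hmom : ∀ m n : ℕ, (m, n) ∈ Ξ → 0 < m + n →
      star (extendByZero H T) ^ m * extendByZero H T ^ n =
        H.starProjection * (star N ^ m * N ^ n) * H.starProjection := fun m n h hmn => by
    rw [← extendByZero_star_pow_mul_pow H T hmn, hTN m n h, extendByZero_compress]
  obtain ⟨U, hU, -⟩ := existsUnique_isUnitaryPolarDecomposition N hN
  obtain ⟨W, hW, -⟩ := existsUnique_isUnitaryPolarDecomposition _ hS
  have hpqΞ := hΞ (Set.mem_insert _ _)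
  have hrΞ := hΞ (Set.mem_insert_of_mem _ rfl)
  obtain ⟨k, rfl⟩ := Nat.exists_eq_add_of_le hpq.le
  obtain ⟨hcomm, habs⟩ := commute_abs_of_compression_moments hP hU.mem_unitary hU.eq_mul_abs
    hU.commute_abs hW.mem_unitary hW.eq_mul_abs hW.commute_abs (k := k) (by omega) (by omega)
    (hmom _ _ hpqΞ (by omega)) (hmom r r hrΞ (by omega))
  have hUd : ∀ U, IsUnitaryPolarDecomposition N U → Commute H.starProjection (U ^ d) := by
    intro U hU
    obtain ⟨u, rfl⟩ : IsUnit U :=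
      ⟨⟨U, star U, (Unitary.mem_iff.1 hU.mem_unitary).2, (Unitary.mem_iff.1 hU.mem_unitary).1⟩, rfl⟩
    rw [hd]
    refine commute_pow_intSetGcd ?_
    rintro _ ⟨⟨m, n⟩, hmn, rfl⟩
    refine hU.commute_pow_natAbs hP.isSelfAdjoint hcomm ?_
    -- The pair `(0, 0)` is not covered by `hmom`, but its moment is the identity.
    obtain h0 | h0 := (m + n).eq_zero_or_pos
    · obtain ⟨rfl, rfl⟩ : m = 0 ∧ n = 0 := by omega
      simp
    · exact commute_star_pow_mul_pow_of_compression_eq hP hcomm habs h0 (hmom m n hmn h0)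
  have hNd : Commute H.starProjection (N ^ d) := by
    have : N ^ d = U ^ d * CFC.abs N ^ d := by rw [← hU.commute_abs.mul_pow, ← hU.eq_mul_abs]
    rw [this]
    exact (hUd U hU).mul_right (hcomm.pow_right d)
  refine ⟨fun n => ?_, hNd, fun V hV => ⟨fun _ => ⟨hcomm, hUd V hV⟩, fun _ => hNd⟩⟩
  obtain rfl | hn := n.eq_zero_or_pos
  · simp [compress_one]
  · refine extendByZero_injective H ?_
    rw [extendByZero_compress, extendByZero_star_pow_mul_pow H T (by omega),
      star_pow_mul_pow_eq_abs_pow, star_pow_mul_pow_eq_abs_pow, habs,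
      hP.compress_pow_of_commute hcomm (by omega)]
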